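/- Let $d\ge 0$ be an integer. An \emph{alcoved polytope} in $\mathbb{R}^d$ is a $d$-dimensional polytope each of whose facets spans a hyperplane of the form $\{y\in\mathbb{R}^d : y_i-y_j=k\}$ with $k\in\mathbb{Z}$ and $i\ne j$ in $\{0,\dots,d\}$, where $y_0:=0$. (A facet is a nonempty face of dimension $d-1$.) Let $$Q_d=\{(y_1,\dots,y_d)\in\mathbb{R}^d : y_i-y_j\le 1 \text{ for all } 0\le i,j\le d\},\qquad y_0:=0.$$ Then $Q_d$ is the unique alcoved polytope of minimal volume among all alcoved polytopes in $\mathbb{R}^d$ that contain the origin in their interior, and it has the following properties. (i) $Q_d$ is centrally symmetric, i.e. $-Q_d=Q_d$. (ii) $Q_d$ has exactly $2\binom{d+1}{2}$ facets. (iii) $Q_d=\operatorname{conv}\big([-1,0]^d\cup[0,1]^d\big)$. It contains exactly $2^{d+1}-1$ points of $\mathbb{Z}^d$; the origin is the only one of them in the interior of $Q_d$, and all the other $2^{d+1}-2$ are vertices of $Q_d$. (iv) $Q_d$ is a projection of the unit cube $[0,1]^{d+1}$, i.e. $Q_d=\varphi([0,1]^{d+1})$ for some surjective linear map $\varphi:\mathbb{R}^{d+1}\to\mathbb{R}^d$.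 Moreover, $Q_d$ has the same $h^*$-vector as $[0,1]^{d+1}$ (up to trailing zeros): there is one polynomial $h\in\mathbb{Z}[z]$, of degree at most $d$, such that $$1+\sum_{t\ge1}|tQ_d\cap\mathbb{Z}^d|\,z^t=\frac{h(z)}{(1-z)^{d+1}}\quad\text{and}\quad 1+\sum_{t\ge1}|t[0,1]^{d+1}\cap\mathbb{Z}^{d+1}|\,z^t=\frac{h(z)}{(1-z)^{d+2}}.$$ -/

import Mathlib

open scoped Pointwise

namespace Alcoved

/-- The coordinates `(y_0, y_1, …, y_d)` of a point `y ∈ ℝ^d`, with the convention `y_0 = 0`. -/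
def ext {d : ℕ} (y : Fin d → ℝ) : Fin (d + 1) → ℝ :=
  Fin.cons 0 y

/-- The alcove hyperplane `{y ∈ ℝ^d | y_i - y_j = k}`, where `0 ≤ i, j ≤ d` and `y_0 = 0`. -/
def alcoveHyperplane {d : ℕ} (i j : Fin (d + 1)) (k : ℤ) : Set (Fin d → ℝ) :=
  {y | ext y i - ext y j = k}

/-- The dimension of a set in `ℝ^n`: the dimension of its affine hull (`0` for the empty set). -/
noncomputable def dim {n : ℕ} (P : Set (Fin n → ℝ)) : ℕ :=
  Module.finrank ℝ (vectorSpan ℝ P)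

/-- A polyhedron: an intersection of finitely many closed half-spaces. -/
def IsPolyhedron {n : ℕ} (P : Set (Fin n → ℝ)) : Prop :=
  ∃ s : Finset (((Fin n → ℝ) →ₗ[ℝ] ℝ) × ℝ), P = {y | ∀ c ∈ s, c.1 y ≤ c.2}

/-- A facet: a nonempty (exposed) face of codimension one. -/
def IsFacet {n : ℕ} (P F : Set (Fin n → ℝ)) : Prop :=
  IsExposed ℝ P F ∧ F.Nonempty ∧ dim F + 1 = dim P

/-- An alcoved polytope in `ℝ^d`: a bounded `d`-dimensional polyhedron all of whose
facet-defining hyperplanes (the affine hulls of its facets) are alcove hyperplanes. -/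
structure IsAlcovedPolytope {d : ℕ} (P : Set (Fin d → ℝ)) : Prop where
  polyhedron : IsPolyhedron P
  bounded : Bornology.IsBounded P
  nonempty : P.Nonempty
  dim_eq : dim P = d
  facets : ∀ F, IsFacet P F →
    ∃ (i j : Fin (d + 1)) (k : ℤ), i ≠ j ∧
      (affineSpan ℝ F : Set (Fin d → ℝ)) = alcoveHyperplane i j k

/-- The polytope `Q_d = {y ∈ ℝ^d | y_i - y_j ≤ 1 for 0 ≤ i, j ≤ d}`, with `y_0 = 0`. -/
def Q (d : ℕ) : Set (Fin d → ℝ) :=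
  {y | ∀ i j : Fin (d + 1), ext y i - ext y j ≤ 1}

/-- The lattice `ℤ^n ⊆ ℝ^n`. -/
def lattice (n : ℕ) : Set (Fin n → ℝ) :=
  {x | ∀ i, ∃ z : ℤ, x i = z}

/-- The number `L_P(t)` of lattice points in the dilate `tP`. -/
noncomputable def latticeCount {n : ℕ} (P : Set (Fin n → ℝ)) (t : ℕ) : ℕ :=
  (((t : ℝ) • P) ∩ lattice n).ncard

/-- The Ehrhart series `1 + ∑_{t ≥ 1} L_P(t) z^t`. -/
noncomputable def ehrhartSeries {n : ℕ} (P : Set (Fin n → ℝ)) : PowerSeries ℤ :=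
  PowerSeries.mk fun t => if t = 0 then 1 else (latticeCount P t : ℤ)

/-- `h` is the `h^*`-polynomial of `P`: its degree is at most `dim P` and
`Ehr_P(z) = h(z) / (1 - z)^(dim P + 1)`. The `h^*`-vector is its vector of coefficients. -/
def IsHStarPolynomial {n : ℕ} (P : Set (Fin n → ℝ)) (h : Polynomial ℤ) : Prop :=
  h.natDegree ≤ dim P ∧
    ehrhartSeries P * (1 - PowerSeries.X) ^ (dim P + 1) = (h : PowerSeries ℤ)

end Alcoved

/-!
The inequalities of an irredundant system are in bijection with the facets of the polyhedron it
defines. Hence an alcoved polytope `P` with the origin in its interior is cut out by half-spaces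
bounded by hyperplanes `y_i - y_j = k` with `k ≠ 0`. Since `|y_i - y_j| ≤ 1` on `Q_d`, no point of
`Q_d` lies strictly beyond such a hyperplane, and so `Q_d ⊆ P`.

Projecting along the diagonal maps the cube `[0, t]^(d+1)` onto `t Q_d`. Each lattice point of
`t Q_d` has exactly one preimage in `{0, …, t}^(d+1)` with a coordinate equal to zero, so there are
`(t + 1)^(d+1) - t^(d+1)` of them. The Ehrhart series of `Q_d` is therefore `1 - z` times that of
the cube.
-/

namespace Alcoved

open MeasureTheory Set Topology

section Polyhedron

variable {ι E : Type*} [AddCommGroup E] [Module ℝ E] {a : ι → E →ₗ[ℝ] ℝ} {b : ι → ℝ}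

/-- The solution set of a system of linear inequalities `a i x ≤ b i`. The index type is kept
arbitrary, so that redundancy is a property of the system and not of the set. -/
def polyhedron (a : ι → E →ₗ[ℝ] ℝ) (b : ι → ℝ) : Set E := {x | ∀ i, a i x ≤ b i}

/-- The face of a polyhedron on which the `i`-th inequality is an equality. -/
def tightFace (a : ι → E →ₗ[ℝ] ℝ) (b : ι → ℝ) (i : ι) : Set E :=
  {x ∈ polyhedron a b | a i x = b i}

/-- A system of linear inequalities is irredundant if dropping any single inequality enlarges its
solution set. -/
def IsIrredundant (a : ι → E →ₗ[ℝ] ℝ) (b : ι → ℝ) : Prop :=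
  ∀ i, ∃ y, b i < a i y ∧ ∀ j ≠ i, a j y ≤ b j

lemma convex_polyhedron (a : ι → E →ₗ[ℝ] ℝ) (b : ι → ℝ) : Convex ℝ (polyhedron a b) := by
  simpa only [polyhedron, ofPred_forall] using
    convex_iInter fun i => convex_halfSpace_le (a i).isLinear (b i)

lemma exists_pos_forall_apply_add_smul_lt [Finite ι] {x : E} (hx : ∀ i, a i x < b i) (v : E) :
    ∃ ε : ℝ, 0 < ε ∧ ∀ i, a i (x + ε • v) < b i := by
  have hnear (i : ι) : ∀ᶠ ε in 𝓝[>] (0 : ℝ), a i (x + ε • v) < b i := by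
    have hcont : Continuous fun ε : ℝ => a i (x + ε • v) := by
      simp only [map_add, map_smul]; fun_prop
    exact nhdsWithin_le_nhds (hcont.continuousAt.eventually_lt_const (by simpa using hx i))
  exact (eventually_mem_nhdsWithin.and (Filter.eventually_all.2 hnear)).exists

/-- The midpoint of two points of the polyhedron is strict wherever one of them is. -/
lemma exists_mem_forall_apply_lt [Finite ι] {C : Set E} (hC : Convex ℝ C) (hne : C.Nonempty)
    (hsub : C ⊆ polyhedron a b) (h : ∀ i, ∃ x ∈ C, a i x < b i) :
    ∃ x ∈ C, ∀ i, a i x < b i := by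
  suffices ∀ s : Set ι, s.Finite → ∃ x ∈ C, ∀ i ∈ s, a i x < b i by
    simpa using this univ finite_univ
  intro s hs
  induction s, hs using Set.Finite.induction_on with
  | empty => exact hne.imp fun x hx => ⟨hx, by simp⟩
  | @insert i s _ _ ih =>
    obtain ⟨x, hx, hxs⟩ := ih
    obtain ⟨y, hy, hyi⟩ := h i
    refine ⟨midpoint ℝ x y, hC.midpoint_mem hx hy, ?_⟩
    have hmid (j : ι) : a j (midpoint ℝ x y) = (a j x + a j y) / 2 := by
      rw [midpoint_eq_smul_add, map_smul, map_add, smul_eq_mul, invOf_eq_inv]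
      ring
    rintro j (rfl | hj)
    · linarith [hmid j, hsub hx j]
    · linarith [hmid j, hxs j hj, hsub hy j]

namespace IsIrredundant

lemma ne_zero (h : IsIrredundant a b) {x : E} (hx : x ∈ polyhedron a b) (i : ι) : a i ≠ 0 := by
  intro hi
  obtain ⟨y, hy, -⟩ := h i
  have hxi := hx i
  simp only [hi, LinearMap.zero_apply] at hy hxi
  exact hy.not_ge hxi

/-- On the segment from `x` to a point that violates the `i`-th inequality only, the other
inequalities remain strict until the `i`-th one becomes tight. -/
lemma exists_apply_eq (h : IsIrredundant a b) {x : E} (hx : ∀ i, a i x < b i) (i : ι) :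
    ∃ z, a i z = b i ∧ ∀ j ≠ i, a j z < b j := by
  obtain ⟨y, hyi, hy⟩ := h i
  have hseg : b i ∈ openSegment ℝ (a i x) (a i y) := by
    rw [openSegment_eq_Ioo ((hx i).trans hyi)]
    exact ⟨hx i, hyi⟩
  obtain ⟨s, t, hs, ht, hst, hbi⟩ := hseg
  refine ⟨s • x + t • y, by simpa using hbi, fun j hj => ?_⟩
  calc a j (s • x + t • y) = s * a j x + t * a j y := by simp
    _ < s * b j + t * b j :=
      add_lt_add_of_lt_of_le (by have := hx j; gcongr) (by have := hy j hj; gcongr)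
    _ = b j := by rw [← add_mul, hst, one_mul]

end IsIrredundant

lemma mem_tightFace_of_forall_ne_lt {z : E} {i : ι} (hzi : a i z = b i)
    (hz : ∀ j ≠ i, a j z < b j) : z ∈ tightFace a b i := by
  refine ⟨fun j => ?_, hzi⟩
  rcases eq_or_ne j i with rfl | hj
  exacts [hzi.le, (hz j hj).le]

lemma IsIrredundant.tightFace_nonempty (h : IsIrredundant a b) {x : E} (hx : ∀ i, a i x < b i)
    (i : ι) : (tightFace a b i).Nonempty := by
  obtain ⟨z, hzi, hz⟩ := h.exists_apply_eq hx i
  exact ⟨z, mem_tightFace_of_forall_ne_lt hzi hz⟩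

lemma IsIrredundant.tightFace_injective (h : IsIrredundant a b) {x : E} (hx : ∀ i, a i x < b i) :
    Function.Injective (tightFace a b) := by
  intro i j hij
  obtain ⟨z, hzi, hz⟩ := h.exists_apply_eq hx i
  have hzj : z ∈ tightFace a b j := hij ▸ mem_tightFace_of_forall_ne_lt hzi hz
  by_contra hne
  exact (hz j (Ne.symm hne)).ne hzj.2

lemma IsIrredundant.vectorSpan_tightFace [Finite ι] (h : IsIrredundant a b) {x : E}
    (hx : ∀ i, a i x < b i) (i : ι) : vectorSpan ℝ (tightFace a b i) = LinearMap.ker (a i) := by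
  obtain ⟨z, hzi, hz⟩ := h.exists_apply_eq hx i
  apply le_antisymm
  · rw [vectorSpan_def, Submodule.span_le]
    rintro _ ⟨u, hu, w, hw, rfl⟩
    simp [hu.2, hw.2]
  · intro v hv
    obtain ⟨ε, hε, hεv⟩ := exists_pos_forall_apply_add_smul_lt
      (a := fun j : {j // j ≠ i} => a j) (b := fun j => b j) (fun j => hz j j.2) v
    have hmem : z + ε • v ∈ tightFace a b i :=
      mem_tightFace_of_forall_ne_lt (by simp [hzi, LinearMap.mem_ker.1 hv])
        fun j hj => hεv ⟨j, hj⟩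
    have hsmul : ε • v ∈ vectorSpan ℝ (tightFace a b i) := by
      simpa using vsub_mem_vectorSpan ℝ hmem (mem_tightFace_of_forall_ne_lt hzi hz)
    exact (Submodule.smul_mem_iff _ hε.ne').1 hsmul

lemma IsIrredundant.affineSpan_tightFace [Finite ι] (h : IsIrredundant a b) {x : E}
    (hx : ∀ i, a i x < b i) (i : ι) :
    (affineSpan ℝ (tightFace a b i) : Set E) = {y | a i y = b i} := by
  obtain ⟨z, hz⟩ := h.tightFace_nonempty hx i
  ext y
  rw [SetLike.mem_coe, ← AffineSubspace.vsub_right_mem_direction_iff_mem (mem_affineSpan ℝ hz),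
    direction_affineSpan, h.vectorSpan_tightFace hx, LinearMap.mem_ker, vsub_eq_sub, map_sub, hz.2,
    sub_eq_zero, mem_ofPred_eq]

section Topology

variable [TopologicalSpace E]

/-- A functional exposing `F` is constant on `F`, so it vanishes on the direction of `F`. -/
lemma eq_of_isExposed_of_vectorSpan_eq {P F G : Set E} (hF : IsExposed ℝ P F) (hne : F.Nonempty)
    (hFG : F ⊆ G) (hGP : G ⊆ P) (hspan : vectorSpan ℝ F = vectorSpan ℝ G) : F = G := by
  obtain ⟨l, rfl⟩ := hF hne
  obtain ⟨z, hz⟩ := hne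
  refine hFG.antisymm fun x hx => ⟨hGP hx, fun y hy => ?_⟩
  have hker : vectorSpan ℝ {x ∈ P | ∀ y ∈ P, l y ≤ l x} ≤ LinearMap.ker l.toLinearMap := by
    rw [vectorSpan_def, Submodule.span_le]
    rintro _ ⟨u, hu, w, hw, rfl⟩
    simp [(hw.2 u hu.1).antisymm (hu.2 w hw.1)]
  have hxz : l x = l z := by
    have hmem := hker (hspan ▸ vsub_mem_vectorSpan ℝ hx (hFG hz))
    simpa [sub_eq_zero] using hmem
  exact hxz ▸ hz.2 y hy

variable [IsTopologicalAddGroup E] [ContinuousSMul ℝ E]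

lemma eq_of_isExposed_of_mem_interior {P F : Set E} (hF : IsExposed ℝ P F) {x : E} (hx : x ∈ F)
    (hxP : x ∈ interior P) : F = P := by
  obtain ⟨l, rfl⟩ := hF ⟨x, hx⟩
  have hl : l = 0 := by
    by_contra hne
    have hopen : l '' P ∈ 𝓝 (l x) :=
      (l.isOpenMap_of_ne_zero hne).image_mem_nhds (mem_interior_iff_mem_nhds.1 hxP)
    obtain ⟨_, hlt, y, hy, rfl⟩ := ((frequently_gt_nhds (l x)).and_eventually hopen).exists
    exact hlt.not_ge (hx.2 y hy)
  simp [hl]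

variable [T2Space E] [FiniteDimensional ℝ E]

lemma isExposed_tightFace (a : ι → E →ₗ[ℝ] ℝ) (b : ι → ℝ) (i : ι) :
    IsExposed ℝ (polyhedron a b) (tightFace a b i) := by
  rintro ⟨z, hz⟩
  refine ⟨LinearMap.toContinuousLinearMap (a i), ?_⟩
  ext x
  refine and_congr_right fun hx => ⟨fun hxi y hy => hxi.symm ▸ hy i, fun hmax => ?_⟩
  exact (hx i).antisymm (hz.2 ▸ hmax z hz.1)

lemma interior_polyhedron [Finite ι] (ha : ∀ i, a i ≠ 0) :
    interior (polyhedron a b) = {x | ∀ i, a i x < b i} := by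
  have hinter (i : ι) : interior {x | a i x ≤ b i} = {x | a i x < b i} := by
    have hopen := (a i).isOpenMap_of_finiteDimensional (LinearMap.surjective (ha i))
    have hcont := (a i).continuous_of_finiteDimensional
    change interior (a i ⁻¹' Iic (b i)) = a i ⁻¹' Iio (b i)
    rw [← hopen.preimage_interior_eq_interior_preimage hcont, interior_Iic]
  simp only [polyhedron, ofPred_forall, interior_iInter_of_finite, hinter]

end Topology

end Polyhedron

section Facets

variable {n : ℕ} {P : Set (Fin n → ℝ)}

lemma dim_eq_of_nonempty_interior (hP : (interior P).Nonempty) : dim P = n := by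
  have hspan : affineSpan ℝ P = ⊤ :=
    affineSpan_eq_top_of_nonempty_interior (hP.mono (interior_mono (subset_convexHull ℝ P)))
  rw [dim, AffineSubspace.vectorSpan_eq_top_of_affineSpan_eq_top _ _ _ hspan, finrank_top,
    Module.finrank_fin_fun]

section IrredundantSystem

variable {ι : Type*} [Finite ι] {a : ι → (Fin n → ℝ) →ₗ[ℝ] ℝ} {b : ι → ℝ} {x : Fin n → ℝ}

lemma IsIrredundant.mem_interior_polyhedron (h : IsIrredundant a b) (hx : ∀ i, a i x < b i) :
    x ∈ interior (polyhedron a b) :=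
  interior_polyhedron (h.ne_zero fun i => (hx i).le) ▸ hx

lemma IsIrredundant.isFacet_tightFace (h : IsIrredundant a b) (hx : ∀ i, a i x < b i) (i : ι) :
    IsFacet (polyhedron a b) (tightFace a b i) := by
  refine ⟨isExposed_tightFace a b i, h.tightFace_nonempty hx i, ?_⟩
  rw [dim_eq_of_nonempty_interior ⟨x, h.mem_interior_polyhedron hx⟩, dim,
    h.vectorSpan_tightFace hx]
  simpa using Module.Dual.finrank_ker_add_one_of_ne_zero (h.ne_zero (fun i => (hx i).le) i)

lemma IsIrredundant.exists_subset_tightFace_of_isFacet (h : IsIrredundant a b)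
    {F : Set (Fin n → ℝ)} (hF : IsFacet (polyhedron a b) F) :
    ∃ i, F ⊆ tightFace a b i := by
  obtain ⟨hexp, hne, hdim⟩ := hF
  by_contra! hnot
  have hstrict (i : ι) : ∃ y ∈ F, a i y < b i := by
    obtain ⟨y, hy, hyi⟩ := not_subset.1 (hnot i)
    have hyP := hexp.subset hy
    exact ⟨y, hy, (hyP i).lt_of_ne fun heq => hyi ⟨hyP, heq⟩⟩
  obtain ⟨y, hy, hlt⟩ := exists_mem_forall_apply_lt (hexp.convex (convex_polyhedron a b)) hne
    hexp.subset hstrict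
  have hFP := eq_of_isExposed_of_mem_interior hexp hy (h.mem_interior_polyhedron hlt)
  rw [hFP] at hdim
  omega

theorem IsIrredundant.setOf_isFacet_polyhedron (h : IsIrredundant a b) (hx : ∀ i, a i x < b i) :
    {F | IsFacet (polyhedron a b) F} = range (tightFace a b) := by
  refine Subset.antisymm (fun F hF => ?_) ?_
  · obtain ⟨i, hi⟩ := h.exists_subset_tightFace_of_isFacet hF
    have hdim : dim F = dim (tightFace a b i) :=
      Nat.add_right_cancel (hF.2.2.trans (h.isFacet_tightFace hx i).2.2.symm)
    have hspan := Submodule.eq_of_le_of_finrank_eq (vectorSpan_mono ℝ hi) hdim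
    exact ⟨i, (eq_of_isExposed_of_vectorSpan_eq hF.1 hF.2.1 hi (fun _ hy => hy.1) hspan).symm⟩
  · rintro _ ⟨i, rfl⟩
    exact h.isFacet_tightFace hx i

lemma IsIrredundant.encard_setOf_isFacet_polyhedron (h : IsIrredundant a b)
    (hx : ∀ i, a i x < b i) : {F | IsFacet (polyhedron a b) F}.encard = ENat.card ι := by
  rw [h.setOf_isFacet_polyhedron hx, ← image_univ, (h.tightFace_injective hx).encard_image,
    encard_univ]

end IrredundantSystem

lemma isPolyhedron_polyhedron {ι : Type*} [Finite ι] (a : ι → (Fin n → ℝ) →ₗ[ℝ] ℝ) (b : ι → ℝ) :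
    IsPolyhedron (polyhedron a b) :=
  ⟨(finite_range fun i => (a i, b i)).toFinset, by ext; simp [polyhedron]⟩

namespace IsPolyhedron

lemma exists_isIrredundant (hP : IsPolyhedron P) :
    ∃ (ι : Type) (_ : Finite ι) (a : ι → (Fin n → ℝ) →ₗ[ℝ] ℝ) (b : ι → ℝ),
      P = polyhedron a b ∧ IsIrredundant a b := by
  classical
  obtain ⟨s, hs, hmin⟩ := exists_minimal_of_wellFoundedLT
    (fun s : Finset (((Fin n → ℝ) →ₗ[ℝ] ℝ) × ℝ) => P = {y | ∀ c ∈ s, c.1 y ≤ c.2}) hP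
  refine ⟨s, inferInstance, fun c => c.1.1, fun c => c.1.2, ?_, fun c => ?_⟩
  · simpa [polyhedron] using hs
  by_contra! hredundant
  have herase : P = {y | ∀ c' ∈ s.erase c, c'.1 y ≤ c'.2} := by
    rw [hs]
    refine Subset.antisymm (fun y hy c' hc' => hy c' (Finset.mem_of_mem_erase hc')) ?_
    intro y hy
    have hyc : c.1.1 y ≤ c.1.2 := by
      by_contra! hlt
      obtain ⟨c', hne, hc'⟩ := hredundant y hlt
      exact hc'.not_ge (hy c' (Finset.mem_erase.2 ⟨Subtype.coe_ne_coe.2 hne, c'.2⟩))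
    intro c' hc'
    rcases eq_or_ne c' c with rfl | hne
    exacts [hyc, hy c' (Finset.mem_erase.2 ⟨hne, hc'⟩)]
  exact Finset.notMem_erase _ _ (hmin herase (Finset.erase_subset _ _) c.2)

lemma convex (hP : IsPolyhedron P) : Convex ℝ P := by
  obtain ⟨ι, _, a, b, rfl, -⟩ := hP.exists_isIrredundant
  exact convex_polyhedron a b

end IsPolyhedron

end Facets

lemma measure_lt_measure_of_isClosed_of_ssubset {E : Type*} [AddCommGroup E] [Module ℝ E]
    [TopologicalSpace E] [IsTopologicalAddGroup E] [ContinuousSMul ℝ E] [MeasurableSpace E]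
    [OpensMeasurableSpace E] {μ : Measure E} [μ.IsOpenPosMeasure] {C P : Set E} (hC : IsClosed C)
    (hμC : μ C ≠ ⊤) (hP : Convex ℝ P) (hint : (interior P).Nonempty) (hCP : C ⊂ P) :
    μ C < μ P := by
  obtain ⟨x, hxP, hxC⟩ := exists_of_ssubset hCP
  have hxcl : x ∈ closure (interior P) := by
    rw [hP.closure_interior_eq_closure_of_nonempty_interior hint]
    exact subset_closure hxP
  have hdiff : (interior (P \ C)).Nonempty := by
    rw [sdiff_eq, interior_inter, hC.isOpen_compl.interior_eq, inter_comm]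
    exact mem_closure_iff.1 hxcl _ hC.isOpen_compl hxC
  calc μ C < μ C + μ (P \ C) :=
        ENNReal.lt_add_right hμC (Measure.measure_pos_of_nonempty_interior μ hdiff).ne'
    _ = μ P := by
        rw [← measure_inter_add_sdiff P hC.measurableSet, inter_eq_right.2 hCP.subset]

section AlcovePolytope

variable {d : ℕ}

@[simp]
lemma ext_zero_index (y : Fin d → ℝ) : ext y 0 = 0 := rfl

@[simp]
lemma ext_succ (y : Fin d → ℝ) (i : Fin d) : ext y i.succ = y i := rfl

lemma ext_add (x y : Fin d → ℝ) : ext (x + y) = ext x + ext y := by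
  ext i
  cases i using Fin.cases <;> simp

lemma ext_smul (c : ℝ) (y : Fin d → ℝ) : ext (c • y) = c • ext y := by
  ext i
  cases i using Fin.cases <;> simp

/-- The linear form `y ↦ y_i - y_j` on `ℝ^d`, with `y_0 = 0`. -/
def alcoveForm (i j : Fin (d + 1)) : (Fin d → ℝ) →ₗ[ℝ] ℝ where
  toFun y := ext y i - ext y j
  map_add' x y := by
    rw [ext_add, Pi.add_apply, Pi.add_apply, add_sub_add_comm]
  map_smul' c y := by
    rw [ext_smul, Pi.smul_apply, Pi.smul_apply, ← smul_sub, RingHom.id_apply]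

lemma alcoveForm_apply (i j : Fin (d + 1)) (y : Fin d → ℝ) :
    alcoveForm i j y = ext y i - ext y j := rfl

lemma mem_Q {y : Fin d → ℝ} : y ∈ Q d ↔ ∀ i j, alcoveForm i j y ≤ 1 := Iff.rfl

/-- The projection `ℝ^(d+1) → ℝ^d` along the diagonal, `x ↦ (x_1 - x_0, …, x_d - x_0)`. -/
def diagonalProj (d : ℕ) : (Fin (d + 1) → ℝ) →ₗ[ℝ] (Fin d → ℝ) where
  toFun x i := x i.succ - x 0
  map_add' x y := by ext i; simp only [Pi.add_apply]; ring
  map_smul' c x := by ext i; simp only [Pi.smul_apply, RingHom.id_apply, smul_eq_mul]; ring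

lemma diagonalProj_apply (x : Fin (d + 1) → ℝ) (i : Fin d) :
    diagonalProj d x i = x i.succ - x 0 := rfl

@[simp]
lemma alcoveForm_diagonalProj (i j : Fin (d + 1)) (x : Fin (d + 1) → ℝ) :
    alcoveForm i j (diagonalProj d x) = x i - x j := by
  have hext (k : Fin (d + 1)) : ext (diagonalProj d x) k = x k - x 0 := by
    cases k using Fin.cases <;> simp [diagonalProj_apply]
  rw [alcoveForm_apply, hext, hext, sub_sub_sub_cancel_right]

@[simp]
lemma diagonalProj_ext_sub (y : Fin d → ℝ) (c : ℝ) : diagonalProj d (fun i => ext y i - c) = y := by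
  ext i
  simp [diagonalProj_apply]

lemma diagonalProj_surjective (d : ℕ) : Function.Surjective (diagonalProj d) :=
  fun y => ⟨_, diagonalProj_ext_sub y 0⟩

lemma image_diagonalProj_Icc (d : ℕ) (t : ℝ) :
    diagonalProj d '' Icc 0 (fun _ => t) = {y | ∀ i j, alcoveForm i j y ≤ t} := by
  ext y
  constructor
  · rintro ⟨x, ⟨hx0, hxt⟩, rfl⟩ i j
    rw [alcoveForm_diagonalProj]
    exact (sub_le_self _ (hx0 j)).trans (hxt i)
  · intro hy
    obtain ⟨m, hm⟩ := Finite.exists_min (ext y)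
    exact ⟨_, ⟨fun i => sub_nonneg.2 (hm i), fun i => hy i m⟩, diagonalProj_ext_sub y _⟩

lemma image_diagonalProj_cube (d : ℕ) : diagonalProj d '' Icc 0 1 = Q d :=
  image_diagonalProj_Icc d 1

lemma smul_cube (n : ℕ) {t : ℝ} (ht : 0 < t) :
    t • Icc (0 : Fin n → ℝ) 1 = Icc 0 fun _ => t := by
  have himage := (OrderIso.smulRight ht).image_Icc (0 : Fin n → ℝ) 1
  simp only [OrderIso.smulRight_apply, image_smul, smul_zero] at himage
  rw [himage]
  congr 1
  ext
  simp

lemma smul_Q (d : ℕ) {t : ℝ} (ht : 0 < t) : t • Q d = {y | ∀ i j, alcoveForm i j y ≤ t} := by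
  rw [← image_diagonalProj_cube, ← image_smul_set, smul_cube _ ht, image_diagonalProj_Icc]

lemma neg_Q (d : ℕ) : -Q d = Q d := by
  have hneg (i j : Fin (d + 1)) (y : Fin d → ℝ) : alcoveForm i j (-y) = alcoveForm j i y := by
    rw [map_neg, alcoveForm_apply, neg_sub, alcoveForm_apply]
  ext y
  rw [mem_neg, mem_Q, mem_Q, forall_comm]
  simp only [hneg]

lemma abs_alcoveForm_le_one {y : Fin d → ℝ} (hy : y ∈ Q d) (i j : Fin (d + 1)) :
    |alcoveForm i j y| ≤ 1 :=
  abs_sub_le_iff.2 ⟨hy i j, hy j i⟩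

lemma isCompact_Q (d : ℕ) : IsCompact (Q d) := by
  rw [← image_diagonalProj_cube]
  exact isCompact_Icc.image (diagonalProj d).continuous_of_finiteDimensional

lemma convex_Q (d : ℕ) : Convex ℝ (Q d) := by
  rw [← image_diagonalProj_cube]
  exact (convex_Icc _ _).linear_image _

lemma Icc_zero_one_subset_Q (d : ℕ) : Icc (0 : Fin d → ℝ) 1 ⊆ Q d := by
  rintro y ⟨hy0, hy1⟩
  rw [← image_diagonalProj_cube]
  refine ⟨ext y, ⟨fun i => ?_, fun i => ?_⟩, by simpa using diagonalProj_ext_sub y 0⟩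
  · cases i using Fin.cases with
    | zero => simp
    | succ i => simpa using hy0 i
  · cases i using Fin.cases with
    | zero => simp
    | succ i => simpa using hy1 i

lemma Q_eq_convexHull (d : ℕ) :
    Q d = convexHull ℝ (Icc (-1 : Fin d → ℝ) 0 ∪ Icc (0 : Fin d → ℝ) 1) := by
  apply Subset.antisymm
  · rw [← image_diagonalProj_cube]
    rintro _ ⟨x, ⟨hx0, hx1⟩, rfl⟩
    have hlower : Fin.tail x - 1 ∈ Icc (-1 : Fin d → ℝ) 0 :=
      ⟨fun i => by simpa [Fin.tail] using hx0 i.succ,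
        fun i => by simpa [Fin.tail] using hx1 i.succ⟩
    have hupper : Fin.tail x ∈ Icc (0 : Fin d → ℝ) 1 := ⟨fun i => hx0 i.succ, fun i => hx1 i.succ⟩
    have hcomb : diagonalProj d x = x 0 • (Fin.tail x - 1) + (1 - x 0) • Fin.tail x := by
      ext i
      simp only [diagonalProj_apply, Fin.tail, Pi.add_apply, Pi.smul_apply, Pi.sub_apply,
        Pi.one_apply, smul_eq_mul]
      ring
    rw [hcomb]
    exact convex_convexHull ℝ _ (subset_convexHull ℝ _ (.inl hlower))
      (subset_convexHull ℝ _ (.inr hupper)) (hx0 0) (sub_nonneg.2 (hx1 0)) (by ring)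
  · refine convexHull_min (union_subset ?_ ?_) (convex_Q d)
    · intro y hy
      rw [← neg_Q]
      exact Icc_zero_one_subset_Q d (by simpa using neg_mem_neg.2 hy)
    · exact Icc_zero_one_subset_Q d

/-- The ordered pairs of distinct indices in `{0, …, d}`, which label the facets of `Q_d`. -/
abbrev IndexPair (d : ℕ) : Type := {p : Fin (d + 1) × Fin (d + 1) // p.1 ≠ p.2}

/-- The forms `y_i - y_j` with `i ≠ j`. Discarding the zero forms `y_i - y_i` makes the system of
inequalities defining `Q_d` irredundant. -/
def facetForm (p : IndexPair d) : (Fin d → ℝ) →ₗ[ℝ] ℝ := alcoveForm p.1.1 p.1.2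

lemma Q_eq_polyhedron (d : ℕ) : Q d = polyhedron (facetForm (d := d)) 1 := by
  refine Subset.antisymm (fun y hy p => hy p.1.1 p.1.2) fun y hy i j => ?_
  rcases eq_or_ne i j with rfl | hij
  · simp
  · exact hy ⟨(i, j), hij⟩

/-- At the projection of `e_i - e_j` the form `y_i - y_j` is `2`, and the others are at most `1`. -/
lemma isIrredundant_facetForm (d : ℕ) : IsIrredundant (facetForm (d := d)) 1 := by
  rintro ⟨⟨i, j⟩, hij : i ≠ j⟩
  refine ⟨diagonalProj d (Pi.single i 1 - Pi.single j 1), ?_, ?_⟩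
  · simp [facetForm, hij, hij.symm]
  · rintro ⟨⟨k, l⟩, hkl : k ≠ l⟩ hne
    simp only [facetForm, alcoveForm_diagonalProj, Pi.sub_apply, Pi.single_apply, Pi.one_apply]
    split_ifs <;> grind

lemma facetForm_zero_lt_one (p : IndexPair d) : facetForm p 0 < (1 : IndexPair d → ℝ) p := by
  simp

lemma interior_Q (d : ℕ) : interior (Q d) = {y | ∀ i j, alcoveForm i j y < 1} := by
  rw [Q_eq_polyhedron, interior_polyhedron
    ((isIrredundant_facetForm d).ne_zero fun p => (facetForm_zero_lt_one p).le)]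
  refine Subset.antisymm (fun y hy i j => ?_) fun y hy p => hy p.1.1 p.1.2
  rcases eq_or_ne i j with rfl | hij
  · simp [alcoveForm_apply]
  · exact hy ⟨(i, j), hij⟩

lemma zero_mem_interior_Q (d : ℕ) : 0 ∈ interior (Q d) := by
  simp [interior_Q]

lemma dim_Q (d : ℕ) : dim (Q d) = d :=
  dim_eq_of_nonempty_interior ⟨0, zero_mem_interior_Q d⟩

lemma isAlcovedPolytope_Q (d : ℕ) : IsAlcovedPolytope (Q d) where
  polyhedron := Q_eq_polyhedron d ▸ isPolyhedron_polyhedron _ _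
  bounded := (isCompact_Q d).isBounded
  nonempty := ⟨0, interior_subset (zero_mem_interior_Q d)⟩
  dim_eq := dim_Q d
  facets F hF := by
    have hirr := isIrredundant_facetForm d
    have hrange : F ∈ range (tightFace facetForm 1) := by
      rwa [← hirr.setOf_isFacet_polyhedron facetForm_zero_lt_one, ← Q_eq_polyhedron]
    obtain ⟨⟨⟨i, j⟩, hij⟩, rfl⟩ := hrange
    refine ⟨i, j, 1, hij, ?_⟩
    rw [hirr.affineSpan_tightFace facetForm_zero_lt_one]
    simp [facetForm, alcoveForm_apply, alcoveHyperplane]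

lemma card_indexPair (d : ℕ) : Nat.card (IndexPair d) = 2 * (d + 1).choose 2 := by
  have hoffDiag (p : Fin (d + 1) × Fin (d + 1)) :
      p ∈ (Finset.univ : Finset (Fin (d + 1))).offDiag ↔ p.1 ≠ p.2 := by simp
  rw [IndexPair, Nat.card_eq_fintype_card, Fintype.card_of_subtype _ hoffDiag,
    Finset.offDiag_card, Finset.card_fin, ← Nat.mul_sub_one, Nat.choose_two_right,
    Nat.mul_div_cancel' (Nat.even_mul_pred_self _).two_dvd]

lemma encard_facets_Q (d : ℕ) :
    {F | IsFacet (Q d) F}.encard = ((2 * (d + 1).choose 2 : ℕ) : ℕ∞) := by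
  rw [Q_eq_polyhedron,
    (isIrredundant_facetForm d).encard_setOf_isFacet_polyhedron facetForm_zero_lt_one,
    ENat.card_eq_coe_natCard, card_indexPair]

end AlcovePolytope

section MinimalVolume

variable {d : ℕ}

/-- A point of `Q_d` violating `l ≤ c` could be shrunk onto the hyperplane `y_i - y_j = k`, which
forces `|k| < 1`; but `k = 0` is excluded because the hyperplane misses the origin. -/
lemma Q_subset_halfSpace {l : (Fin d → ℝ) →ₗ[ℝ] ℝ} {c : ℝ} (hc : 0 < c) {i j : Fin (d + 1)}
    {k : ℤ} (hl : {y | l y = c} = alcoveHyperplane i j k) : Q d ⊆ {y | l y ≤ c} := by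
  have hmem (y : Fin d → ℝ) : l y = c ↔ alcoveForm i j y = k := Set.ext_iff.1 hl y
  have hk : k ≠ 0 := by
    rintro rfl
    exact hc.ne (by simpa using (hmem 0).2 (by simp))
  intro x hx
  by_contra hnot
  have hlt : c < l x := not_le.1 hnot
  have hlx : 0 < l x := hc.trans hlt
  have hscaled : c / l x * alcoveForm i j x = k := by
    simpa using (hmem ((c / l x) • x)).1 (by simp [hlx.ne'])
  have habs : |(k : ℝ)| < 1 :=
    calc |(k : ℝ)| = c / l x * |alcoveForm i j x| := by
          rw [← hscaled, abs_mul, abs_of_pos (div_pos hc hlx)]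
      _ ≤ c / l x := mul_le_of_le_one_right (div_pos hc hlx).le (abs_alcoveForm_le_one hx i j)
      _ < 1 := (div_lt_one hlx).2 hlt
  exact hk (Int.abs_lt_one_iff.1 (by exact_mod_cast habs))

theorem Q_subset_of_isAlcovedPolytope {P : Set (Fin d → ℝ)} (hP : IsAlcovedPolytope P)
    (h0 : 0 ∈ interior P) : Q d ⊆ P := by
  obtain ⟨ι, _, a, b, rfl, hirr⟩ := hP.polyhedron.exists_isIrredundant
  have hstrict (i : ι) : a i 0 < b i := by
    rw [interior_polyhedron (hirr.ne_zero (interior_subset h0))] at h0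
    exact h0 i
  intro x hx r
  obtain ⟨i, j, k, -, hspan⟩ := hP.facets _ (hirr.isFacet_tightFace hstrict r)
  rw [hirr.affineSpan_tightFace hstrict] at hspan
  exact Q_subset_halfSpace (by simpa using hstrict r) hspan hx

theorem measure_Q_lt_measure {μ : Measure (Fin d → ℝ)} [μ.IsOpenPosMeasure]
    [IsFiniteMeasureOnCompacts μ] {P : Set (Fin d → ℝ)} (hP : IsAlcovedPolytope P)
    (h0 : 0 ∈ interior P) (hne : P ≠ Q d) : μ (Q d) < μ P :=
  measure_lt_measure_of_isClosed_of_ssubset (isCompact_Q d).isClosed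
    (isCompact_Q d).measure_lt_top.ne hP.polyhedron.convex ⟨0, h0⟩
    ((Q_subset_of_isAlcovedPolytope hP h0).ssubset_of_ne hne.symm)

end MinimalVolume

section LatticePoints

variable {d n t : ℕ}

/-- The point of `ℝ^n` with the given natural coordinates. -/
def natPoint (x : Fin n → ℕ) : Fin n → ℝ := fun i => x i

lemma natPoint_injective : Function.Injective (natPoint (n := n)) :=
  fun _ _ h => funext fun i => Nat.cast_injective (congrFun h i)

lemma Icc_inter_lattice (b : Fin n → ℕ) : Icc 0 (natPoint b) ∩ lattice n = natPoint '' Iic b := by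
  ext y
  constructor
  · rintro ⟨⟨hy0, hyb⟩, hl⟩
    choose z hz using hl
    have hz0 (i : Fin n) : 0 ≤ z i := Int.cast_nonneg_iff.1 ((hy0 i).trans_eq (hz i))
    lift z to Fin n → ℕ using hz0
    obtain rfl : y = natPoint z := funext fun i => by simp [natPoint, hz]
    exact ⟨z, fun i => Nat.cast_le.1 (hyb i), rfl⟩
  · rintro ⟨x, hx, rfl⟩
    exact ⟨⟨fun i => Nat.cast_nonneg (x i), fun i => Nat.cast_le.2 (hx i)⟩, fun i => ⟨x i, rfl⟩⟩

lemma ext_mem_lattice {y : Fin d → ℝ} (hy : y ∈ lattice d) : ext y ∈ lattice (d + 1) := by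
  intro i
  cases i using Fin.cases with
  | zero => exact ⟨0, by simp⟩
  | succ i => exact hy i

lemma diagonalProj_mem_lattice {x : Fin (d + 1) → ℝ} (hx : x ∈ lattice (d + 1)) :
    diagonalProj d x ∈ lattice d := by
  choose z hz using hx
  exact fun i => ⟨z i.succ - z 0, by simp [diagonalProj_apply, hz]⟩

lemma sub_const_mem_lattice {x : Fin n → ℝ} (hx : x ∈ lattice n) (m : Fin n) :
    (fun i => x i - x m) ∈ lattice n := by
  choose z hz using hx
  exact fun i => ⟨z i - z m, by simp [hz]⟩

lemma latticeCount_cube (n : ℕ) (ht : t ≠ 0) :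
    latticeCount (Icc (0 : Fin n → ℝ) 1) t = (t + 1) ^ n := by
  have hbox : (t : ℝ) • Icc (0 : Fin n → ℝ) 1 ∩ lattice n = natPoint '' Iic fun _ => t := by
    rw [smul_cube n (by positivity)]
    exact Icc_inter_lattice _
  rw [latticeCount, hbox, ncard_image_of_injective _ natPoint_injective, ← Finset.coe_Iic,
    ncard_coe_finset, Pi.card_Iic]
  simp

/-- The points of `{0, …, t}^(d+1)` with a coordinate equal to zero. They represent the lattice
points of the cube `[0, t]^(d+1)` modulo `(1, …, 1)`, which spans the kernel of `diagonalProj d`. -/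
def reducedBox (d t : ℕ) : Finset (Fin (d + 1) → ℕ) :=
  Finset.Iic (fun _ => t) \ Finset.Icc 1 fun _ => t

lemma mem_reducedBox {x : Fin (d + 1) → ℕ} :
    x ∈ reducedBox d t ↔ (∀ i, x i ≤ t) ∧ ∃ i, x i = 0 := by
  simp only [reducedBox, Finset.mem_sdiff, Finset.mem_Iic, Finset.mem_Icc, Pi.le_def, Pi.one_apply]
  refine and_congr_right fun h => ?_
  simp only [h, implies_true, and_true, not_forall, Nat.not_le, Nat.lt_one_iff]

lemma card_reducedBox (d t : ℕ) : (reducedBox d t).card = (t + 1) ^ (d + 1) - t ^ (d + 1) := by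
  rw [reducedBox, Finset.card_sdiff_of_subset Finset.Icc_subset_Iic_self, Pi.card_Iic, Pi.card_Icc]
  simp

lemma injOn_diagonalProj_natPoint (d t : ℕ) :
    InjOn (diagonalProj d ∘ natPoint) (reducedBox d t) := by
  intro x hx y hy h
  obtain ⟨-, i, hi⟩ := mem_reducedBox.1 hx
  obtain ⟨-, j, hj⟩ := mem_reducedBox.1 hy
  have hcross (k l : Fin (d + 1)) : x k + y l = y k + x l := by
    have hkl := congrArg (alcoveForm k l) h
    simp only [Function.comp_apply, alcoveForm_diagonalProj, natPoint] at hkl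
    exact_mod_cast sub_eq_sub_iff_add_eq_add.1 hkl
  ext k
  have hij := hcross i j
  have hki := hcross k i
  omega

lemma smul_Q_inter_lattice (ht : t ≠ 0) :
    ((t : ℝ) • Q d) ∩ lattice d = (diagonalProj d ∘ natPoint) '' (reducedBox d t) := by
  rw [smul_Q d (by positivity)]
  apply Subset.antisymm
  · rintro y ⟨hy, hl⟩
    obtain ⟨m, hm⟩ := Finite.exists_min (ext y)
    have hbox : (fun i => ext y i - ext y m) ∈
        Icc 0 (natPoint fun _ => t) ∩ lattice (d + 1) :=
      ⟨⟨fun i => sub_nonneg.2 (hm i), fun i => hy i m⟩,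
        sub_const_mem_lattice (ext_mem_lattice hl) m⟩
    rw [Icc_inter_lattice] at hbox
    obtain ⟨x, hxt, hx⟩ := hbox
    have hxm : x m = 0 := by simpa [natPoint] using congrFun hx m
    refine ⟨x, mem_reducedBox.2 ⟨hxt, m, hxm⟩, ?_⟩
    rw [Function.comp_apply, hx, diagonalProj_ext_sub]
  · rintro _ ⟨x, hx, rfl⟩
    have hbox : natPoint x ∈ Icc 0 (natPoint fun _ => t) ∩ lattice (d + 1) :=
      Icc_inter_lattice _ ▸ mem_image_of_mem natPoint (mem_reducedBox.1 hx).1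
    exact ⟨image_diagonalProj_Icc d t ▸ mem_image_of_mem _ hbox.1, diagonalProj_mem_lattice hbox.2⟩

lemma encard_smul_Q_inter_lattice (d : ℕ) (ht : t ≠ 0) :
    (((t : ℝ) • Q d) ∩ lattice d).encard = (((t + 1) ^ (d + 1) - t ^ (d + 1) : ℕ) : ℕ∞) := by
  rw [smul_Q_inter_lattice ht, (injOn_diagonalProj_natPoint d t).encard_image,
    encard_coe_eq_coe_finsetCard, card_reducedBox]

lemma latticeCount_Q (d : ℕ) (ht : t ≠ 0) :
    latticeCount (Q d) t = (t + 1) ^ (d + 1) - t ^ (d + 1) := by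
  rw [latticeCount, ncard, encard_smul_Q_inter_lattice d ht, ENat.toNat_natCast]

lemma encard_Q_inter_lattice (d : ℕ) :
    (Q d ∩ lattice d).encard = ((2 ^ (d + 1) - 1 : ℕ) : ℕ∞) := by
  simpa using encard_smul_Q_inter_lattice d one_ne_zero

lemma zero_mem_lattice (n : ℕ) : 0 ∈ lattice n := fun _ => ⟨0, by simp⟩

lemma encard_Q_inter_lattice_diff_zero (d : ℕ) :
    ((Q d ∩ lattice d) \ {0}).encard = ((2 ^ (d + 1) - 2 : ℕ) : ℕ∞) := by
  have hzero : 0 ∈ Q d ∩ lattice d :=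
    ⟨interior_subset (zero_mem_interior_Q d), zero_mem_lattice d⟩
  rw [encard_sdiff_singleton_of_mem hzero, encard_Q_inter_lattice]
  rfl

lemma interior_Q_inter_lattice (d : ℕ) : interior (Q d) ∩ lattice d = {0} := by
  apply Subset.antisymm
  · rintro y ⟨hy, hl⟩
    rw [interior_Q] at hy
    ext i
    obtain ⟨z, hz⟩ := hl i
    have hupper : y i < 1 := by simpa [alcoveForm_apply] using hy i.succ 0
    have hlower : -y i < 1 := by simpa [alcoveForm_apply] using hy 0 i.succ
    have hz0 : z = 0 := Int.abs_lt_one_iff.1 (by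
      exact_mod_cast abs_lt.2 ⟨neg_lt.1 (hz ▸ hlower), hz ▸ hupper⟩)
    simp [hz, hz0]
  · rintro _ rfl
    exact ⟨zero_mem_interior_Q d, zero_mem_lattice d⟩

lemma alcoveForm_eq_one_of_mem_openSegment {u v y : Fin d → ℝ} (hu : u ∈ Q d) (hv : v ∈ Q d)
    (hy : y ∈ openSegment ℝ u v) {i j : Fin (d + 1)} (hij : alcoveForm i j y = 1) :
    alcoveForm i j u = 1 := by
  obtain ⟨p, q, hp, hq, hpq, rfl⟩ := hy
  rw [map_add, map_smul, map_smul, smul_eq_mul, smul_eq_mul] at hij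
  refine (mem_Q.1 hu i j).antisymm (le_of_not_gt fun hlt => hij.not_lt ?_)
  calc p * alcoveForm i j u + q * alcoveForm i j v < p * 1 + q * 1 :=
        add_lt_add_of_lt_of_le (by gcongr) (by have := mem_Q.1 hv i j; gcongr)
    _ = 1 := by rw [mul_one, mul_one, hpq]

lemma eq_of_forall_alcoveForm_eq {u y : Fin d → ℝ} (j : Fin (d + 1))
    (h : ∀ k, alcoveForm k j u = alcoveForm k j y) : u = y := by
  have hext (z : Fin d → ℝ) : diagonalProj d (fun k => alcoveForm k j z) = z :=
    diagonalProj_ext_sub z _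
  rw [← hext u, ← hext y, funext h]

/-- A nonzero lattice point is the projection of a `0/1`-vector taking both values. Every inequality
between a coordinate `1` and a coordinate `0` is tight there, and these determine the point. -/
lemma lattice_subset_extremePoints_Q (d : ℕ) :
    (Q d ∩ lattice d) \ {0} ⊆ extremePoints ℝ (Q d) := by
  rintro y ⟨hy, hne : y ≠ 0⟩
  refine mem_extremePoints_iff_left.2 ⟨hy.1, fun u hu v hv hyuv => ?_⟩
  obtain ⟨x, hx, rfl⟩ : y ∈ (diagonalProj d ∘ natPoint) '' (reducedBox d 1) := by
    rw [← smul_Q_inter_lattice one_ne_zero]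
    simpa using hy
  obtain ⟨hx1, j, hj⟩ := mem_reducedBox.1 hx
  have hzero_or_one (k : Fin (d + 1)) : x k = 0 ∨ x k = 1 :=
    Nat.le_one_iff_eq_zero_or_eq_one.1 (hx1 k)
  obtain ⟨i, hi⟩ : ∃ i, x i = 1 := by
    by_contra! hnone
    have hx0 : x = 0 := funext fun k => (hzero_or_one k).resolve_right (hnone k)
    exact hne (by ext; simp [hx0, natPoint, diagonalProj_apply])
  have htight {k l : Fin (d + 1)} (hk : x k = 1) (hl : x l = 0) : alcoveForm k l u = 1 :=
    alcoveForm_eq_one_of_mem_openSegment hu hv hyuv (by simp [natPoint, hk, hl])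
  refine eq_of_forall_alcoveForm_eq j fun k => ?_
  rw [Function.comp_apply, alcoveForm_diagonalProj, natPoint, natPoint, hj]
  rcases hzero_or_one k with hk | hk
  · have hcocycle : alcoveForm k j u = alcoveForm i j u - alcoveForm i k u := by
      simp only [alcoveForm_apply, sub_sub_sub_cancel_left]
    rw [hcocycle, htight hi hj, htight hi hk, hk]
    simp
  · rw [htight hk hj, hk]
    simp

end LatticePoints

section EhrhartSeries

open Polynomial (derivative)

/-- The generating function `∑ (t + 1)^n z^t`, which is the Ehrhart series of `[0, 1]^n`. -/
noncomputable def powSeries (n : ℕ) : PowerSeries ℤ :=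
  PowerSeries.mk fun t => ((t : ℤ) + 1) ^ n

lemma powSeries_succ (n : ℕ) : powSeries (n + 1) =
    powSeries n + PowerSeries.X * PowerSeries.derivative ℤ (powSeries n) := by
  ext t
  cases t with
  | zero => simp [powSeries]
  | succ t =>
    simp only [powSeries, PowerSeries.coeff_mk, map_add, PowerSeries.coeff_succ_X_mul,
      PowerSeries.coeff_derivative]
    push_cast
    ring

/-- The Eulerian polynomials, normalized to have constant term `1`. The recursion is the one that
`powSeries_succ` forces on the numerators of `powSeries n = eulerianPoly n / (1 - z)^(n + 1)`. -/
noncomputable def eulerianPoly : ℕ → Polynomial ℤ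
  | 0 => 1
  | n + 1 => (1 + (n : Polynomial ℤ) * Polynomial.X) * eulerianPoly n +
      Polynomial.X * (1 - Polynomial.X) * derivative (eulerianPoly n)

lemma powSeries_mul_one_sub_X_pow (n : ℕ) :
    powSeries n * (1 - PowerSeries.X) ^ (n + 1) = (eulerianPoly n : PowerSeries ℤ) := by
  induction n with
  | zero =>
    have hgeom : powSeries 0 = PowerSeries.mk 1 := by ext; simp [powSeries]
    rw [hgeom, zero_add, pow_one, PowerSeries.mk_one_mul_one_sub_eq_one, eulerianPoly,
      Polynomial.coe_one]
  | succ n ih =>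
    have hderiv := congrArg (PowerSeries.derivative ℤ) ih
    rw [PowerSeries.derivative_coe, Derivation.leibniz, Derivation.leibniz_pow, map_sub,
      PowerSeries.derivative_X, Derivation.map_one_eq_zero] at hderiv
    simp only [smul_eq_mul, nsmul_eq_mul, Nat.add_sub_cancel] at hderiv
    have hcast : ((n : Polynomial ℤ) : PowerSeries ℤ) = n :=
      map_natCast (Polynomial.coeToPowerSeries.ringHom (R := ℤ)) n
    rw [powSeries_succ, eulerianPoly]
    push_cast at hderiv ⊢
    rw [hcast, ← hderiv, ← ih]
    ring

lemma natDegree_eulerianPoly_succ_le (n : ℕ) : (eulerianPoly (n + 1)).natDegree ≤ n := by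
  induction n with
  | zero => simp [eulerianPoly]
  | succ n ih =>
    rw [eulerianPoly]
    refine Polynomial.natDegree_add_le_of_degree_le ?_ ?_
    · have hlin : (1 + ((n + 1 : ℕ) : Polynomial ℤ) * Polynomial.X).natDegree ≤ 1 := by
        compute_degree
      exact (Polynomial.natDegree_mul_le_of_le hlin ih).trans_eq (add_comm 1 n)
    · rcases Nat.eq_zero_or_pos (eulerianPoly (n + 1)).natDegree with hconst | hpos
      · simp [Polynomial.derivative_of_natDegree_zero hconst]
      · have hquad : (Polynomial.X * (1 - Polynomial.X) : Polynomial ℤ).natDegree ≤ 2 := by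
          compute_degree
        have hderiv := Polynomial.natDegree_derivative_le (eulerianPoly (n + 1))
        exact (Polynomial.natDegree_mul_le_of_le hquad hderiv).trans (by omega)

lemma dim_cube (n : ℕ) : dim (Icc (0 : Fin n → ℝ) 1) = n := by
  refine dim_eq_of_nonempty_interior ⟨fun _ => 1 / 2, ?_⟩
  rw [← pi_univ_Icc, interior_pi_set finite_univ]
  intro i _
  change (1 / 2 : ℝ) ∈ interior (Icc 0 1)
  rw [interior_Icc]
  norm_num

lemma ehrhartSeries_cube (n : ℕ) : ehrhartSeries (Icc (0 : Fin n → ℝ) 1) = powSeries n := by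
  ext t
  rw [ehrhartSeries, powSeries, PowerSeries.coeff_mk, PowerSeries.coeff_mk]
  split_ifs with ht
  · simp [ht]
  · rw [latticeCount_cube n ht]
    push_cast
    rfl

lemma ehrhartSeries_Q (d : ℕ) :
    ehrhartSeries (Q d) = powSeries (d + 1) * (1 - PowerSeries.X) := by
  ext t
  rw [mul_sub, mul_one, map_sub]
  cases t with
  | zero => simp [ehrhartSeries, powSeries]
  | succ t =>
    rw [PowerSeries.coeff_succ_mul_X, ehrhartSeries, powSeries, PowerSeries.coeff_mk,
      PowerSeries.coeff_mk, PowerSeries.coeff_mk, if_neg t.succ_ne_zero,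
      latticeCount_Q d t.succ_ne_zero, Nat.cast_sub (Nat.pow_le_pow_left (Nat.le_succ _) _)]
    push_cast
    rfl

lemma isHStarPolynomial_cube (d : ℕ) :
    IsHStarPolynomial (Icc (0 : Fin (d + 1) → ℝ) 1) (eulerianPoly (d + 1)) := by
  rw [IsHStarPolynomial, dim_cube, ehrhartSeries_cube]
  exact ⟨(natDegree_eulerianPoly_succ_le d).trans d.le_succ, powSeries_mul_one_sub_X_pow (d + 1)⟩

lemma isHStarPolynomial_Q (d : ℕ) : IsHStarPolynomial (Q d) (eulerianPoly (d + 1)) := by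
  rw [IsHStarPolynomial, dim_Q, ehrhartSeries_Q, mul_assoc, ← pow_succ']
  exact ⟨natDegree_eulerianPoly_succ_le d, powSeries_mul_one_sub_X_pow (d + 1)⟩

end EhrhartSeries

end Alcoved

theorem mainTheorem6 (d : ℕ) :
    -- `Q_d` is the unique alcoved polytope of minimal volume with the origin in its interior
    (Alcoved.IsAlcovedPolytope (Alcoved.Q d) ∧ 0 ∈ interior (Alcoved.Q d) ∧
      ∀ P : Set (Fin d → ℝ), Alcoved.IsAlcovedPolytope P → 0 ∈ interior P →
        P ≠ Alcoved.Q d → MeasureTheory.volume (Alcoved.Q d) < MeasureTheory.volume P) ∧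
    -- central symmetry
    -Alcoved.Q d = Alcoved.Q d ∧
    -- number of facets
    {F | Alcoved.IsFacet (Alcoved.Q d) F}.encard = ((2 * (d + 1).choose 2 : ℕ) : ℕ∞) ∧
    -- convex hull of the two cubes; lattice points, interior lattice points and vertices
    Alcoved.Q d = convexHull ℝ
      (Set.Icc (-1 : Fin d → ℝ) 0 ∪ Set.Icc (0 : Fin d → ℝ) 1) ∧
    (Alcoved.Q d ∩ Alcoved.lattice d).encard = ((2 ^ (d + 1) - 1 : ℕ) : ℕ∞) ∧
    interior (Alcoved.Q d) ∩ Alcoved.lattice d = {0} ∧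
    ((Alcoved.Q d ∩ Alcoved.lattice d) \ {0}).encard = ((2 ^ (d + 1) - 2 : ℕ) : ℕ∞) ∧
    (Alcoved.Q d ∩ Alcoved.lattice d) \ {0} ⊆ Set.extremePoints ℝ (Alcoved.Q d) ∧
    -- projection of the unit cube of dimension `d + 1`
    (∃ φ : (Fin (d + 1) → ℝ) →ₗ[ℝ] (Fin d → ℝ), Function.Surjective φ ∧
      φ '' Set.Icc (0 : Fin (d + 1) → ℝ) 1 = Alcoved.Q d) ∧
    -- same `h^*`-vector as that cube
    (∃ h : Polynomial ℤ, Alcoved.IsHStarPolynomial (Alcoved.Q d) h ∧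
      Alcoved.IsHStarPolynomial (Set.Icc (0 : Fin (d + 1) → ℝ) 1) h) := by
  exact ⟨⟨Alcoved.isAlcovedPolytope_Q d, Alcoved.zero_mem_interior_Q d,
      fun _ hP h0 hne => Alcoved.measure_Q_lt_measure hP h0 hne⟩,
    Alcoved.neg_Q d, Alcoved.encard_facets_Q d, Alcoved.Q_eq_convexHull d,
    Alcoved.encard_Q_inter_lattice d, Alcoved.interior_Q_inter_lattice d,
    Alcoved.encard_Q_inter_lattice_diff_zero d, Alcoved.lattice_subset_extremePoints_Q d,
    ⟨Alcoved.diagonalProj d, Alcoved.diagonalProj_surjective d, Alcoved.image_diagonalProj_cube d⟩,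
    ⟨Alcoved.eulerianPoly (d + 1), Alcoved.isHStarPolynomial_Q d,
      Alcoved.isHStarPolynomial_cube d⟩⟩
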